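/- Let $\mathrm{SO}(3)$ carry its normalized Haar measure $\mu$, and write $\mathbf R(\alpha,\beta,\gamma)=\mathbf R_z(\alpha)\mathbf R_y(\beta)\mathbf R_z(\gamma)$ with Euler angles $\alpha,\gamma\in\mathbb R/2\pi\mathbb Z$, $\beta\in[0,\pi]$. For $n\in\mathbb N_0$ and integers $|k|,|l|\le n$ let $$d_n^{k,l}(x)=(-1)^{\nu}\binom{2n-s}{s+a}^{1/2}\binom{s+b}{b}^{-1/2}\Big(\frac{1-x}{2}\Big)^{a/2}\Big(\frac{1+x}{2}\Big)^{b/2}P_s^{a,b}(x),\qquad x\in[-1,1],$$ where $a=|k-l|$, $b=|k+l|$, $s=n-\max\{|k|,|l|\}$, $\nu=k+l$ if $k>l$ and $\nu=0$ otherwise, and $P_s^{a,b}$ is the Jacobi polynomial. Let $$D_n^{k,l}(\mathbf R(\alpha,\beta,\gamma))=\sqrt{2n+1}\,e^{-ik\alpha}\,d_n^{k,l}(\cos\beta)\,e^{-il\gamma}$$ be the Wigner-D functions. Let $N$ be a nonnegative integer and let $f$ be $N$-band-limited, i.e. as an element of $L^2(\mathrm{SO}(3))$ it lies in $\bigoplus_{n=0}^N\operatorname{span}\{D_n^{k,l}: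 |k|,|l|\le n\}$. Let $\hat f_n^{k,l}=\int_{\mathrm{SO}(3)} f\,\overline{D_n^{k,l}}\,d\mu$ be its harmonic coefficients, and for $k,j,l\in\{-N,\dots,N\}$ let $$\hat g_{k,j,l}=i^{\,k-l}\sum_{n=\max\{|k|,|j|,|l|\}}^{N}\sqrt{2n+1}\;d_n^{j,k}(0)\,d_n^{j,l}(0)\,\hat f_n^{-k,-l}$$ be its Wigner transform (the Fourier coefficients of its Double Fourier Sphere transform $(\alpha,\beta,\gamma)\mapsto f(\mathbf R(\alpha,\beta,\gamma))$). Then the following are equivalent: (i) $f(\mathbf R)=f(\mathbf R^{-1})$ for $\mu$-almost all $\mathbf R\in\mathrm{SO}(3)$; (ii) $\hat f_n^{k,l}=(-1)^{k+l}\,\hat f_n^{-l,-k}$ for all $0\le n\le N$ and $|k|,|l|\le n$; (iii) $\hat g_{k,j,l}=\hat g_{-l,-j,-k}$ for all $k,j,l\in\{-N,\dots,N\}$. -/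

import Mathlib

open MeasureTheory

/-- The rotation group `SO(3)`: real `3 × 3` matrices with `Rᵀ R = 1` and `det R = 1`. -/
abbrev SO3 : Type := Matrix.specialOrthogonalGroup (Fin 3) ℝ

namespace SO3

/-! ### Topology and normalized Haar measure -/

theorem transpose_mul_self (R : SO3) : (R : Matrix (Fin 3) (Fin 3) ℝ).transpose * R = 1 := by
  have h := (Matrix.mem_specialOrthogonalGroup_iff.1 R.2).1
  simpa [Matrix.star_eq_conjTranspose] using (Matrix.mem_orthogonalGroup_iff' (Fin 3) ℝ).1 h

theorem mul_transpose_self (R : SO3) : (R : Matrix (Fin 3) (Fin 3) ℝ) *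
    (R : Matrix (Fin 3) (Fin 3) ℝ).transpose = 1 := by
  have h := (Matrix.mem_specialOrthogonalGroup_iff.1 R.2).1
  simpa [Matrix.star_eq_conjTranspose] using (Matrix.mem_orthogonalGroup_iff (Fin 3) ℝ).1 h

theorem mem_iff (A : Matrix (Fin 3) (Fin 3) ℝ) :
    A ∈ Matrix.specialOrthogonalGroup (Fin 3) ℝ ↔ A.transpose * A = 1 ∧ A.det = 1 := by
  rw [Matrix.mem_specialOrthogonalGroup_iff, Matrix.mem_orthogonalGroup_iff']

instance : IsTopologicalGroup SO3 where
  continuous_mul := continuous_mul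
  continuous_inv := by
    have h : Continuous fun R : SO3 => star (R : Matrix (Fin 3) (Fin 3) ℝ) :=
      continuous_star.comp continuous_subtype_val
    exact h.subtype_mk _

instance : CompactSpace SO3 := by
  suffices h : IsCompact (Matrix.specialOrthogonalGroup (Fin 3) ℝ :
      Set (Matrix (Fin 3) (Fin 3) ℝ)) from isCompact_iff_compactSpace.1 h
  have hsub : (Matrix.specialOrthogonalGroup (Fin 3) ℝ : Set (Matrix (Fin 3) (Fin 3) ℝ)) ⊆
      Set.pi Set.univ fun _ : Fin 3 => Set.pi Set.univ fun _ : Fin 3 => Set.Icc (-1 : ℝ) 1 := by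
    intro A hA i _ j _
    have h := congrFun (congrFun (transpose_mul_self ⟨A, hA⟩) j) j
    simp only [Matrix.mul_apply, Matrix.transpose_apply, Matrix.one_apply_eq] at h
    have h1 : A i j * A i j ≤ 1 := by
      rw [← h]
      exact Finset.single_le_sum (f := fun i => A i j * A i j)
        (fun i _ => mul_self_nonneg _) (Finset.mem_univ i)
    exact abs_le.1 (abs_le_one_iff_mul_self_le_one.2 h1)
  have hK : IsCompact (Set.pi Set.univ fun _ : Fin 3 => Set.pi Set.univ fun _ : Fin 3 =>
      Set.Icc (-1 : ℝ) 1) :=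
    isCompact_univ_pi fun _ => isCompact_univ_pi fun _ => isCompact_Icc
  refine IsCompact.of_isClosed_subset hK ?_ hsub
  have hset : (Matrix.specialOrthogonalGroup (Fin 3) ℝ : Set (Matrix (Fin 3) (Fin 3) ℝ)) =
      {A | A.transpose * A = 1} ∩ {A | A.det = 1} := by
    ext A
    exact mem_iff A
  rw [hset]
  exact (isClosed_eq (by fun_prop) continuous_const).inter
    (isClosed_eq (by fun_prop) continuous_const)

instance : MeasurableSpace SO3 := borel SO3

instance : BorelSpace SO3 := ⟨rfl⟩

/-- The Haar measure `μ` of `SO(3)`, normalized to total mass one. -/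
noncomputable def haar : Measure SO3 := Measure.haarMeasure ⊤

/-! ### Euler angles -/

/-- Rotation by the angle `ω` about the `z`-axis. -/
noncomputable def rotZ (ω : ℝ) : SO3 :=
  ⟨!![Real.cos ω, -Real.sin ω, 0; Real.sin ω, Real.cos ω, 0; 0, 0, 1], by
    have h := Real.sin_sq_add_cos_sq ω
    rw [mem_iff]
    constructor
    · ext i j
      fin_cases i <;> fin_cases j <;> simp [Matrix.mul_apply, Fin.sum_univ_three] <;> nlinarith
    · simp [Matrix.det_fin_three]
      nlinarith⟩

/-- Rotation by the angle `ω` about the `y`-axis. -/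
noncomputable def rotY (ω : ℝ) : SO3 :=
  ⟨!![Real.cos ω, 0, Real.sin ω; 0, 1, 0; -Real.sin ω, 0, Real.cos ω], by
    have h := Real.sin_sq_add_cos_sq ω
    rw [mem_iff]
    constructor
    · ext i j
      fin_cases i <;> fin_cases j <;> simp [Matrix.mul_apply, Fin.sum_univ_three] <;> nlinarith
    · simp [Matrix.det_fin_three]
      nlinarith⟩

/-- The rotation `R(α, β, γ) = R_z(α) R_y(β) R_z(γ)` with Euler angles `α, β, γ`. -/
noncomputable def euler (α β γ : ℝ) : SO3 := rotZ α * rotY β * rotZ γ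

theorem exists_angle {x y r : ℝ} (hr : 0 ≤ r) (h : x ^ 2 + y ^ 2 = r ^ 2) :
    ∃ θ : ℝ, x = r * Real.cos θ ∧ y = r * Real.sin θ := by
  have hn : ‖(⟨x, y⟩ : ℂ)‖ = r := by
    rw [Complex.norm_def, Complex.normSq_mk, ← Real.sqrt_sq hr, ← h]
    congr 1
    ring
  refine ⟨Complex.arg ⟨x, y⟩, ?_, ?_⟩
  · rw [← hn, Complex.norm_mul_cos_arg]
  · rw [← hn, Complex.norm_mul_sin_arg]

theorem coe_euler (α β γ : ℝ) : (euler α β γ : Matrix (Fin 3) (Fin 3) ℝ) =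
    !![Real.cos α * Real.cos β * Real.cos γ - Real.sin α * Real.sin γ,
       -(Real.cos α * Real.cos β * Real.sin γ) - Real.sin α * Real.cos γ,
       Real.cos α * Real.sin β;
       Real.sin α * Real.cos β * Real.cos γ + Real.cos α * Real.sin γ,
       -(Real.sin α * Real.cos β * Real.sin γ) + Real.cos α * Real.cos γ,
       Real.sin α * Real.sin β;
       -(Real.sin β * Real.cos γ), Real.sin β * Real.sin γ, Real.cos β] := by
  ext i j
  fin_cases i <;> fin_cases j <;>
    simp [euler, rotZ, rotY] <;> ring

/-- A rotation whose last column is the third unit vector is a rotation about the `z`-axis. -/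
theorem exists_rotZ (M : SO3) (h0 : M.1 0 2 = 0) (h1 : M.1 1 2 = 0) (h2 : M.1 2 2 = 1) :
    ∃ γ, M = rotZ γ := by
  have hr := congrFun (congrFun (mul_transpose_self M) 2) 2
  have hc := congrFun (congrFun (transpose_mul_self M) 0) 0
  have hc1 := congrFun (congrFun (transpose_mul_self M) 1) 1
  have hc01 := congrFun (congrFun (transpose_mul_self M) 0) 1
  have hd := ((mem_iff _).1 M.2).2
  simp [Matrix.mul_apply, Fin.sum_univ_three] at hr hc hc1 hc01
  rw [Matrix.det_fin_three] at hd
  have h20 : M.1 2 0 = 0 := by rw [h2] at hr; nlinarith [sq_nonneg (M.1 2 1), sq_nonneg (M.1 2 0)]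
  have h21 : M.1 2 1 = 0 := by rw [h2] at hr; nlinarith [sq_nonneg (M.1 2 1), sq_nonneg (M.1 2 0)]
  simp only [h0, h1, h2, h20, h21] at hr hc hc1 hc01 hd
  obtain ⟨γ, hx, hy⟩ := exists_angle (x := M.1 0 0) (y := M.1 1 0) zero_le_one (by nlinarith)
  refine ⟨γ, Subtype.ext ?_⟩
  have e1 : M.1 1 1 = M.1 0 0 := by
    nlinarith [sq_nonneg (M.1 1 1 - M.1 0 0), sq_nonneg (M.1 0 1 + M.1 1 0)]
  have e2 : M.1 0 1 = -M.1 1 0 := by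
    nlinarith [sq_nonneg (M.1 1 1 - M.1 0 0), sq_nonneg (M.1 0 1 + M.1 1 0)]
  rw [one_mul] at hx hy
  ext i j
  fin_cases i <;> fin_cases j <;> simp [rotZ, h0, h1, h2, h20, h21, e1, e2, hx, hy]

/-- Every rotation has Euler angles. -/
theorem exists_euler (R : SO3) :
    ∃ p : ℝ × ℝ × ℝ, p.2.1 ∈ Set.Icc 0 Real.pi ∧ euler p.1 p.2.1 p.2.2 = R := by
  have hc := congrFun (congrFun (transpose_mul_self R) 2) 2
  simp [Matrix.mul_apply, Fin.sum_univ_three] at hc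
  have hle : R.1 2 2 * R.1 2 2 ≤ 1 := by
    nlinarith [mul_self_nonneg (R.1 0 2), mul_self_nonneg (R.1 1 2)]
  have habs := abs_le.1 (abs_le_one_iff_mul_self_le_one.2 hle)
  set β := Real.arccos (R.1 2 2) with hβ
  have hcos : Real.cos β = R.1 2 2 := Real.cos_arccos habs.1 habs.2
  have hs := Real.sin_sq_add_cos_sq β
  have hβm : β ∈ Set.Icc 0 Real.pi := ⟨Real.arccos_nonneg _, Real.arccos_le_pi _⟩
  obtain ⟨α, hx, hy⟩ := exists_angle (x := R.1 0 2) (y := R.1 1 2)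
    (Real.sin_nonneg_of_mem_Icc hβm) (by nlinarith)
  have ha := Real.sin_sq_add_cos_sq α
  have hinv : ∀ S : SO3, (S⁻¹).1 = S.1.transpose := fun S => by
    change star S.1 = _
    rw [Matrix.star_eq_conjTranspose, Matrix.conjTranspose_eq_transpose_of_trivial]
  obtain ⟨γ, hγ⟩ := exists_rotZ ((rotZ α * rotY β)⁻¹ * R)
    (by
      have e : ((rotZ α * rotY β)⁻¹ * R).1 = (rotZ α * rotY β).1.transpose * R.1 := by
        rw [← hinv]; rfl
      rw [e]
      simp [rotZ, rotY, Matrix.mul_apply, Fin.sum_univ_three, hx, hy, ← hcos]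
      linear_combination (Real.cos β * Real.sin β) * ha)
    (by
      have e : ((rotZ α * rotY β)⁻¹ * R).1 = (rotZ α * rotY β).1.transpose * R.1 := by
        rw [← hinv]; rfl
      rw [e]
      simp [rotZ, rotY, Matrix.mul_apply, Fin.sum_univ_three, hx, hy]
      ring)
    (by
      have e : ((rotZ α * rotY β)⁻¹ * R).1 = (rotZ α * rotY β).1.transpose * R.1 := by
        rw [← hinv]; rfl
      rw [e]
      simp [rotZ, rotY, Matrix.mul_apply, Fin.sum_univ_three, hx, hy, ← hcos]
      linear_combination (Real.sin β ^ 2) * ha + hs)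
  refine ⟨(α, β, γ), hβm, ?_⟩
  rw [euler, ← hγ, mul_inv_cancel_left]

/-- Euler angles `(α, β, γ)` of a rotation, with `β ∈ [0, π]`. -/
noncomputable def eulerAngles (R : SO3) : ℝ × ℝ × ℝ := (exists_euler R).choose

/-! ### Wigner functions -/

/-- The Jacobi polynomial `P_s^{a,b}` of degree `s` with parameters `a, b`. -/
noncomputable def jacobiP (s a b : ℕ) (x : ℝ) : ℝ :=
  ∑ m ∈ Finset.range (s + 1), ((s + a).choose (s - m) : ℝ) * ((s + b).choose m : ℝ) *
    ((x - 1) / 2) ^ m * ((x + 1) / 2) ^ (s - m)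

/-- The Wigner-d function `d_n^{k,l}` on `[-1, 1]`, for `|k|, |l| ≤ n`; here `a = |k - l|`,
`b = |k + l|`, `s = n - max |k| |l|`, and `ν = k + l` if `k > l` and `ν = 0` otherwise. -/
noncomputable def wignerd (n : ℕ) (k l : ℤ) (x : ℝ) : ℝ :=
  let a : ℕ := (k - l).natAbs
  let b : ℕ := (k + l).natAbs
  let s : ℕ := n - max k.natAbs l.natAbs
  let ν : ℤ := if l < k then k + l else 0
  (-1 : ℝ) ^ ν * √((2 * n - s).choose (s + a) : ℝ) * (√((s + b).choose b : ℝ))⁻¹ *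
    ((1 - x) / 2) ^ ((a : ℝ) / 2) * ((1 + x) / 2) ^ ((b : ℝ) / 2) * jacobiP s a b x

/-- The value `√(2n+1) e^{-ikα} d_n^{k,l}(cos β) e^{-ilγ}`. -/
noncomputable def wignerDAngles (n : ℕ) (k l : ℤ) (α β γ : ℝ) : ℂ :=
  (√(2 * n + 1 : ℝ) : ℂ) * Complex.exp (-Complex.I * k * α) * (wignerd n k l (Real.cos β) : ℂ) *
    Complex.exp (-Complex.I * l * γ)

/-- The `L²`-normalized Wigner-D function `D_n^{k,l} : SO(3) → ℂ`, for `|k|, |l| ≤ n`. By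
`wignerD_euler` below its value does not depend on the chosen Euler angles. -/
noncomputable def wignerD (n : ℕ) (k l : ℤ) (R : SO3) : ℂ :=
  wignerDAngles n k l (eulerAngles R).1 (eulerAngles R).2.1 (eulerAngles R).2.2

theorem exp_eq_zpow (k : ℤ) (α : ℝ) : Complex.exp (-Complex.I * k * α) =
    (⟨Real.cos α, Real.sin α⟩ : ℂ) ^ (-k) := by
  have h : (⟨Real.cos α, Real.sin α⟩ : ℂ) = Complex.exp (α * Complex.I) := by
    apply Complex.ext
    · rw [Complex.exp_ofReal_mul_I_re]
    · rw [Complex.exp_ofReal_mul_I_im]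
  rw [h, ← Complex.exp_int_mul]
  congr 1
  push_cast
  ring

theorem wignerd_one (n : ℕ) {k l : ℤ} (h : k ≠ l) : wignerd n k l 1 = 0 := by
  have h0 : (k - l).natAbs ≠ 0 := Int.natAbs_ne_zero.2 (sub_ne_zero.2 h)
  have h1 : (((k - l).natAbs : ℕ) : ℝ) / 2 ≠ 0 := div_ne_zero (Nat.cast_ne_zero.2 h0) two_ne_zero
  simp only [wignerd, sub_self, zero_div, Real.zero_rpow h1, mul_zero, zero_mul]

theorem wignerd_neg_one (n : ℕ) {k l : ℤ} (h : k ≠ -l) : wignerd n k l (-1) = 0 := by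
  have h0 : (k + l).natAbs ≠ 0 := Int.natAbs_ne_zero.2 fun h' => h (eq_neg_of_add_eq_zero_left h')
  have h1 : (((k + l).natAbs : ℕ) : ℝ) / 2 ≠ 0 := div_ne_zero (Nat.cast_ne_zero.2 h0) two_ne_zero
  simp only [wignerd, add_neg_cancel, zero_div, Real.zero_rpow h1, mul_zero, zero_mul]

theorem wignerDAngles_congr (n : ℕ) (k l : ℤ) {α β γ α' β' γ' : ℝ}
    (hβ : β ∈ Set.Icc 0 Real.pi) (hβ' : β' ∈ Set.Icc 0 Real.pi)
    (h : euler α β γ = euler α' β' γ') :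
    wignerDAngles n k l α β γ = wignerDAngles n k l α' β' γ' := by
  have hm := congrArg Subtype.val h
  rw [coe_euler, coe_euler] at hm
  have e22 := congrFun (congrFun hm 2) 2
  simp at e22
  obtain rfl := Real.injOn_cos hβ hβ' e22
  have e00 := congrFun (congrFun hm 0) 0
  have e02 := congrFun (congrFun hm 0) 2
  have e12 := congrFun (congrFun hm 1) 2
  have e10 := congrFun (congrFun hm 1) 0
  have e20 := congrFun (congrFun hm 2) 0
  have e21 := congrFun (congrFun hm 2) 1
  simp at e00 e02 e12 e10 e20 e21
  by_cases hs : Real.sin β = 0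
  · have hp : Real.cos β = 1 ∨ Real.cos β = -1 := Real.sin_eq_zero_iff_cos_eq.1 hs
    rcases hp with hp | hp
    · simp only [wignerDAngles, hp]
      by_cases hkl : k = l
      · subst hkl
        rw [hp] at e00 e10
        have key : ∀ a c : ℝ, Complex.exp (-Complex.I * k * a) * Complex.exp (-Complex.I * k * c) =
            (⟨Real.cos (a + c), Real.sin (a + c)⟩ : ℂ) ^ (-k) := fun a c => by
          rw [← exp_eq_zpow, ← Complex.exp_add]
          congr 1
          push_cast
          ring
        have k2 : Complex.exp (-Complex.I * k * α) * Complex.exp (-Complex.I * k * γ) =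
            Complex.exp (-Complex.I * k * α') * Complex.exp (-Complex.I * k * γ') := by
          rw [key, key]
          congr 2
          · rw [Real.cos_add, Real.cos_add]; linarith
          · rw [Real.sin_add, Real.sin_add]; linarith
        linear_combination ((√(2 * n + 1 : ℝ) : ℂ) * (wignerd n k k 1 : ℂ)) * k2
      · simp [wignerd_one n hkl]
    · simp only [wignerDAngles, hp]
      by_cases hkl : k = -l
      · subst hkl
        rw [hp] at e00 e10
        have key : ∀ a c : ℝ, Complex.exp (-Complex.I * (-l : ℤ) * a) *
            Complex.exp (-Complex.I * l * c) =
            (⟨Real.cos (c - a), Real.sin (c - a)⟩ : ℂ) ^ (-l) := fun a c => by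
          rw [← exp_eq_zpow, ← Complex.exp_add]
          congr 1
          push_cast
          ring
        have k2 : Complex.exp (-Complex.I * (-l : ℤ) * α) * Complex.exp (-Complex.I * l * γ) =
            Complex.exp (-Complex.I * (-l : ℤ) * α') * Complex.exp (-Complex.I * l * γ') := by
          rw [key, key]
          congr 2
          · rw [Real.cos_sub, Real.cos_sub]; linarith
          · rw [Real.sin_sub, Real.sin_sub]; linarith
        linear_combination ((√(2 * n + 1 : ℝ) : ℂ) * (wignerd n (-l) l (-1) : ℂ)) * k2
      · simp [wignerd_neg_one n hkl]
  · simp only [hs, or_false] at e02 e12 e20 e21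
    simp only [wignerDAngles, exp_eq_zpow, e02, e12, e20, e21]

/-- The defining formula of the Wigner-D functions, for all Euler angles. -/
theorem wignerD_euler (n : ℕ) (k l : ℤ) (α γ : ℝ) {β : ℝ} (hβ : β ∈ Set.Icc 0 Real.pi) :
    wignerD n k l (euler α β γ) =
      (√(2 * n + 1 : ℝ) : ℂ) * Complex.exp (-Complex.I * k * α) *
        (wignerd n k l (Real.cos β) : ℂ) * Complex.exp (-Complex.I * l * γ) :=
  wignerDAngles_congr n k l (exists_euler _).choose_spec.1 hβ (exists_euler _).choose_spec.2

/-! ### Band-limited functions, harmonic coefficients, Wigner transform -/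

/-- The harmonic subspace `Harm_n(SO(3))`, spanned by the Wigner-D functions of degree `n`. -/
noncomputable def harm (n : ℕ) : Submodule ℂ (SO3 → ℂ) :=
  Submodule.span ℂ {g | ∃ k l : ℤ, |k| ≤ n ∧ |l| ≤ n ∧ g = wignerD n k l}

/-- `f` is `N`-band-limited: as an element of `L²(SO(3))`, i.e. up to equality almost everywhere,
it lies in the sum of the harmonic subspaces of degrees `0, …, N`. -/
def IsBandLimited (N : ℕ) (f : SO3 → ℂ) : Prop :=
  ∃ g ∈ ⨆ (n : ℕ) (_ : n ≤ N), harm n, f =ᵐ[haar] g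

/-- The harmonic coefficient `⟨f, D_n^{k,l}⟩` in `L²(SO(3))`. -/
noncomputable def fhat (f : SO3 → ℂ) (n : ℕ) (k l : ℤ) : ℂ :=
  ∫ R, f R * (starRingEnd ℂ) (wignerD n k l R) ∂haar

/-- The Wigner transform of bandwidth `N`, mapping a family `c` of harmonic coefficients to the
Fourier coefficients of the DFS transform. -/
noncomputable def wignerTransform (N : ℕ) (c : ℕ → ℤ → ℤ → ℂ) (k j l : ℤ) : ℂ :=
  Complex.I ^ (k - l) *
    ∑ n ∈ Finset.Icc (max (max k.natAbs l.natAbs) j.natAbs) N,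
      (√(2 * n + 1 : ℝ) : ℂ) * (wignerd n j k 0 : ℂ) * (wignerd n j l 0 : ℂ) * c n (-k) (-l)

end SO3

namespace SO3

/-! ### The Haar measure is invariant under inversion -/

/-! Inversion acts on Wigner functions by a signed relabelling, D_n^{k,l}(R⁻¹) = (-1)^{k+l}
D_n^{-l,-k}(R) (`wignerD_inv`). As Haar measure is inversion invariant, R ↦ f(R⁻¹) has coefficients
(-1)^{k+l} f̂_n^{-l,-k} (`fhat_comp_inv`), so (i) gives (ii). Conversely, under (ii) the difference
f(R) - f(R⁻¹) is band-limited with vanishing coefficients, hence orthogonal to itself and zero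
almost everywhere. This needs no orthogonality relations between the Wigner functions.

For (ii) ⇔ (iii), the reflected transform ĝ_{-l,-j,-k} is the transform of (-1)^{k+l} f̂_n^{-l,-k}
(`wignerTransform_neg_swap`). It remains to see that the Wigner transform is injective: for fixed k,
l it is a triangular system in j and n, with diagonal entries nonzero because d_j^{j,k}(0) ≠ 0. -/

instance : haar.IsHaarMeasure := by unfold haar; infer_instance

instance : IsProbabilityMeasure haar :=
  ⟨by simpa [haar] using Measure.haarMeasure_self (K₀ := (⊤ : TopologicalSpace.PositiveCompacts SO3))⟩

instance : haar.IsMulRightInvariant where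
  map_mul_right_eq_self g := by
    have : IsProbabilityMeasure (Measure.map (· * g) haar) :=
      Measure.isProbabilityMeasure_map (measurable_mul_const g).aemeasurable
    exact Measure.isHaarMeasure_eq_of_isProbabilityMeasure _ _

/-- Right invariance of `haar` makes `haar.inv` left invariant, hence a multiple of `haar`; total
mass one forces the factor 1. -/
instance : haar.IsInvInvariant where
  inv_eq_self := by
    have : IsProbabilityMeasure haar.inv :=
      Measure.isProbabilityMeasure_map measurable_inv.aemeasurable
    have key := Measure.isMulInvariant_eq_smul_of_compactSpace haar.inv haar
    have h1 := congrArg (fun ν : Measure SO3 => ν Set.univ) key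
    simp only [measure_univ, Measure.smul_apply, ENNReal.smul_def, smul_eq_mul, mul_one] at h1
    rw [key, show Measure.haarScalarFactor haar.inv haar = 1 by exact_mod_cast h1.symm, one_smul]

/-! ### Continuity of the Wigner functions -/

theorem rotZ_sub_int_mul_two_pi (ω : ℝ) (m : ℤ) : rotZ (ω - m * (2 * Real.pi)) = rotZ ω := by
  apply Subtype.ext
  simp only [rotZ, Real.cos_sub_int_mul_two_pi, Real.sin_sub_int_mul_two_pi]

theorem exists_rotZ_eq_mem_Icc (ω : ℝ) :
    ∃ ω' ∈ Set.Icc 0 (2 * Real.pi), rotZ ω' = rotZ ω := by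
  refine ⟨toIcoMod Real.two_pi_pos 0 ω, ?_, ?_⟩
  · simpa using Set.Ico_subset_Icc_self (toIcoMod_mem_Ico Real.two_pi_pos 0 ω)
  · rw [← self_sub_toIcoDiv_zsmul, zsmul_eq_mul, rotZ_sub_int_mul_two_pi]

/-- A compact box of Euler angles covering `SO(3)`. -/
abbrev EulerBox : Type :=
  Set.Icc 0 (2 * Real.pi) × Set.Icc 0 Real.pi × Set.Icc 0 (2 * Real.pi)

/-- The rotation with the given Euler angles in the compact box. -/
noncomputable def ofEulerBox (p : EulerBox) : SO3 := euler p.1 p.2.1 p.2.2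

theorem continuous_ofEulerBox : Continuous ofEulerBox := by
  refine continuous_induced_rng.2 ?_
  have h : (Subtype.val ∘ ofEulerBox) = fun p : EulerBox => (euler p.1 p.2.1 p.2.2).1 := rfl
  simp only [h, coe_euler]
  refine continuous_matrix fun i j => ?_
  fin_cases i <;> fin_cases j <;> simp <;> fun_prop

theorem surjective_ofEulerBox : Function.Surjective ofEulerBox := by
  intro R
  obtain ⟨⟨α, β, γ⟩, hβ, rfl⟩ := exists_euler R
  obtain ⟨α', hα, eα⟩ := exists_rotZ_eq_mem_Icc α
  obtain ⟨γ', hγ, eγ⟩ := exists_rotZ_eq_mem_Icc γ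
  exact ⟨(⟨α', hα⟩, ⟨β, hβ⟩, ⟨γ', hγ⟩), by simp only [ofEulerBox, euler, eα, eγ]⟩

/-- Lets continuity on `SO3` be tested in Euler angles, although `eulerAngles` is an arbitrary
choice. -/
theorem isQuotientMap_ofEulerBox : Topology.IsQuotientMap ofEulerBox :=
  continuous_ofEulerBox.isClosedMap.isQuotientMap continuous_ofEulerBox surjective_ofEulerBox

theorem continuous_wignerd (n : ℕ) (k l : ℤ) : Continuous (wignerd n k l) := by
  unfold wignerd jacobiP
  -- Nonnegative exponents make the real powers continuous even at base 0.
  have h (m : ℕ) : (0 : ℝ) ≤ (m : ℝ) / 2 := by positivity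
  have h1 := Real.continuous_rpow_const (h (k - l).natAbs)
  have h2 := Real.continuous_rpow_const (h (k + l).natAbs)
  have h3 : Continuous fun x : ℝ => (1 - x) / 2 := by fun_prop
  have h4 : Continuous fun x : ℝ => (1 + x) / 2 := by fun_prop
  exact ((continuous_const.mul (h1.comp h3)).mul (h2.comp h4)).mul (by fun_prop)

theorem continuous_wignerD (n : ℕ) (k l : ℤ) : Continuous (wignerD n k l) := by
  rw [isQuotientMap_ofEulerBox.continuous_iff]
  have h : wignerD n k l ∘ ofEulerBox = fun p : EulerBox =>
      (√(2 * n + 1 : ℝ) : ℂ) * Complex.exp (-Complex.I * k * (p.1 : ℝ)) *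
        (wignerd n k l (Real.cos p.2.1) : ℂ) * Complex.exp (-Complex.I * l * (p.2.2 : ℝ)) :=
    funext fun p => wignerD_euler n k l _ _ p.2.1.2
  rw [h]
  have := continuous_wignerd n k l
  fun_prop

/-! ### Symmetries of the Wigner functions -/

theorem wignerd_neg_swap (n : ℕ) (k l : ℤ) (x : ℝ) : wignerd n (-l) (-k) x = wignerd n k l x := by
  have e1 : (-l - -k).natAbs = (k - l).natAbs := by congr 1; ring
  have e2 : (-l + -k).natAbs = (k + l).natAbs := by rw [← Int.natAbs_neg]; congr 1; ring
  have e3 : (-1 : ℝ) ^ (if -k < -l then -l + -k else 0) =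
      (-1 : ℝ) ^ (if l < k then k + l else 0) := by
    by_cases h : l < k
    · rw [if_pos h, if_pos (neg_lt_neg h), show -l + -k = -(k + l) by ring, zpow_neg,
        ← inv_zpow, inv_neg_one]
    · rw [if_neg h, if_neg (by simpa using h)]
  simp only [wignerd, e1, e2, e3, Int.natAbs_neg, max_comm l.natAbs]

theorem neg_one_zpow_mul_self {K : Type*} [DivisionRing K] (m : ℤ) :
    (-1 : K) ^ m * (-1) ^ m = 1 := by
  rw [← zpow_add₀ (by simp), ← two_mul, (even_two_mul m).neg_one_zpow]

/-- Only ν changes: for k ≠ l exactly one of the two sides carries the sign (-1)^{k+l}, and for k =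
l this sign is 1. -/
theorem wignerd_neg_neg (n : ℕ) (k l : ℤ) (x : ℝ) :
    wignerd n (-k) (-l) x = (-1) ^ (k + l) * wignerd n k l x := by
  have e1 : (-k - -l).natAbs = (k - l).natAbs := by rw [← Int.natAbs_neg]; congr 1; ring
  have e2 : (-k + -l).natAbs = (k + l).natAbs := by rw [← Int.natAbs_neg]; congr 1; ring
  have e3 : (-1 : ℝ) ^ (if -l < -k then -k + -l else 0) =
      (-1) ^ (k + l) * (-1 : ℝ) ^ (if l < k then k + l else 0) := by
    rcases lt_trichotomy l k with h | rfl | h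
    · rw [if_pos h, if_neg (by simpa using h.le), neg_one_zpow_mul_self, zpow_zero]
    · simp [zpow_add₀, neg_one_zpow_mul_self]
    · rw [if_neg h.not_gt, if_pos (neg_lt_neg h), show -k + -l = -(k + l) by ring, zpow_neg,
        ← inv_zpow, inv_neg_one, zpow_zero, mul_one]
  simp only [wignerd, e1, e2, e3, Int.natAbs_neg]
  ring

/-- Here s = 0, so the Jacobi factor is 1 and every remaining factor is nonzero at x = 0. -/
theorem wignerd_self_ne_zero {j : ℕ} {k : ℤ} (hk : |k| ≤ j) : wignerd j j k 0 ≠ 0 := by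
  have h0 := abs_le.1 hk
  have hs : j - max (j : ℤ).natAbs k.natAbs = 0 := by omega
  have hc : 0 < (2 * j - 0).choose (0 + ((j : ℤ) - k).natAbs) := Nat.choose_pos (by omega)
  simp only [wignerd, hs, jacobiP]
  have h2 : (0 : ℝ) < 1 / 2 := by norm_num
  have := Real.sqrt_pos.2 (Nat.cast_pos.2 hc : (0 : ℝ) < _)
  have h3 := Real.rpow_pos_of_pos h2 ((((j : ℤ) - k).natAbs : ℝ) / 2)
  have h4 := Real.rpow_pos_of_pos h2 ((((j : ℤ) + k).natAbs : ℝ) / 2)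
  have h5 : (-1 : ℝ) ^ (if k < (j : ℤ) then (j : ℤ) + k else 0) ≠ 0 := zpow_ne_zero _ (by norm_num)
  simp only [sub_zero, add_zero, zero_add, Nat.choose_self, Nat.choose_zero_right,
    Finset.range_one, Finset.sum_singleton, pow_zero, Nat.cast_one, Real.sqrt_one, inv_one,
    mul_one, Nat.sub_zero] at this ⊢
  exact mul_ne_zero (mul_ne_zero (mul_ne_zero h5 this.ne') h3.ne') h4.ne'

/-- R_y(-β) = R_z(π) R_y(β) R_z(-π); the shifts by π keep the middle angle in [0, π], as
`wignerD_euler` requires. -/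
theorem euler_inv (α β γ : ℝ) :
    (euler α β γ)⁻¹ = euler (Real.pi - γ) β (-Real.pi - α) := by
  have hinv : ((euler α β γ)⁻¹).1 = (euler α β γ).1.transpose := by
    change star (euler α β γ).1 = _
    rw [Matrix.star_eq_conjTranspose, Matrix.conjTranspose_eq_transpose_of_trivial]
  have hcos : Real.cos (-Real.pi - α) = -Real.cos α := by
    rw [← Real.cos_neg]; simp [Real.cos_add]
  have hsin : Real.sin (-Real.pi - α) = Real.sin α := by simp [Real.sin_sub]
  apply Subtype.ext
  rw [hinv, coe_euler, coe_euler, hcos, hsin, Real.cos_pi_sub, Real.sin_pi_sub]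
  ext i j
  fin_cases i <;> fin_cases j <;> simp <;> ring

theorem wignerD_inv (n : ℕ) (k l : ℤ) (R : SO3) :
    wignerD n k l R⁻¹ = (-1) ^ (k + l) * wignerD n (-l) (-k) R := by
  obtain ⟨⟨α, β, γ⟩, hβ, rfl⟩ := exists_euler R
  simp only at hβ ⊢
  rw [euler_inv, wignerD_euler _ _ _ _ _ hβ, wignerD_euler _ _ _ _ _ hβ, wignerd_neg_swap]
  have hpi (m : ℤ) : Complex.exp (m * (Real.pi * Complex.I)) = (-1 : ℂ) ^ m := by
    rw [Complex.exp_int_mul, Complex.exp_pi_mul_I]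
  have e1 : Complex.exp (-Complex.I * k * ((Real.pi - γ : ℝ) : ℂ)) =
      (-1) ^ k * Complex.exp (-Complex.I * (-k : ℤ) * γ) := by
    rw [show (-1 : ℂ) ^ k = (-1) ^ (-k) by rw [zpow_neg, ← inv_zpow, inv_neg_one], ← hpi,
      ← Complex.exp_add]
    congr 1
    push_cast
    ring
  have e2 : Complex.exp (-Complex.I * l * ((-Real.pi - α : ℝ) : ℂ)) =
      (-1) ^ l * Complex.exp (-Complex.I * (-l : ℤ) * α) := by
    rw [← hpi, ← Complex.exp_add]
    congr 1
    push_cast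
    ring
  rw [e1, e2, zpow_add₀ (by norm_num)]
  ring

theorem conj_neg_one_zpow (m : ℤ) : (starRingEnd ℂ) ((-1) ^ m) = (-1) ^ m := by
  rw [map_zpow₀, map_neg, map_one]

/-! ### Band-limited functions -/

/-- The space of functions spanned by the Wigner-D functions of degrees `0, …, N`. -/
noncomputable abbrev harmLE (N : ℕ) : Submodule ℂ (SO3 → ℂ) := ⨆ (n : ℕ) (_ : n ≤ N), harm n

theorem harmLE_le {N : ℕ} {W : Submodule ℂ (SO3 → ℂ)}
    (h : ∀ (n : ℕ) (k l : ℤ), n ≤ N → |k| ≤ n → |l| ≤ n → wignerD n k l ∈ W) : harmLE N ≤ W := by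
  refine iSup₂_le fun n hn => Submodule.span_le.2 ?_
  rintro _ ⟨k, l, hk, hl, rfl⟩
  exact h n k l hn hk hl

theorem wignerD_mem_harmLE {N n : ℕ} {k l : ℤ} (hn : n ≤ N) (hk : |k| ≤ n) (hl : |l| ≤ n) :
    wignerD n k l ∈ harmLE N :=
  (le_iSup₂ (f := fun (n : ℕ) (_ : n ≤ N) => harm n) n hn)
    (Submodule.subset_span ⟨k, l, hk, hl, rfl⟩)

theorem comp_inv_mem_harmLE {N : ℕ} {g : SO3 → ℂ} (hg : g ∈ harmLE N) :
    (fun R => g R⁻¹) ∈ harmLE N := by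
  have h : harmLE N ≤ (harmLE N).comap (LinearMap.funLeft ℂ ℂ (fun R : SO3 => R⁻¹)) := by
    refine harmLE_le fun n k l hn hk hl => ?_
    have e : LinearMap.funLeft ℂ ℂ (fun R : SO3 => R⁻¹) (wignerD n k l) =
        (-1 : ℂ) ^ (k + l) • wignerD n (-l) (-k) := funext fun R => wignerD_inv n k l R
    rw [Submodule.mem_comap, e]
    exact Submodule.smul_mem _ _ (wignerD_mem_harmLE hn (by rwa [abs_neg]) (by rwa [abs_neg]))
  exact h hg

theorem continuous_of_mem_harmLE {N : ℕ} {g : SO3 → ℂ} (hg : g ∈ harmLE N) : Continuous g := by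
  let W : Submodule ℂ (SO3 → ℂ) :=
    { carrier := {g | Continuous g}
      add_mem' := fun h1 h2 => h1.add h2
      zero_mem' := continuous_zero
      smul_mem' := fun c _ h => h.const_smul c }
  exact harmLE_le (W := W) (fun n k l _ _ _ => continuous_wignerD n k l) hg

theorem integrable_of_continuous {g : SO3 → ℂ} (hg : Continuous g) : Integrable g haar :=
  hg.integrable_of_hasCompactSupport (HasCompactSupport.of_compactSpace g)

/-- A function orthogonal to all Wigner-D functions of degree at most `N` is orthogonal to their
span. -/
theorem integral_mul_conj_eq_zero {N : ℕ} {u g : SO3 → ℂ} (hu : Continuous u) (hg : g ∈ harmLE N)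
    (h : ∀ (n : ℕ) (k l : ℤ), n ≤ N → |k| ≤ n → |l| ≤ n → fhat u n k l = 0) :
    ∫ R, u R * (starRingEnd ℂ) (g R) ∂haar = 0 := by
  have hint {v : SO3 → ℂ} (hv : Continuous v) :
      Integrable (fun R => u R * (starRingEnd ℂ) (v R)) haar :=
    integrable_of_continuous (hu.mul (Complex.continuous_conj.comp hv))
  -- Continuity is included because additivity of the integral needs integrability.
  let W : Submodule ℂ (SO3 → ℂ) :=
    { carrier := {g | Continuous g ∧ ∫ R, u R * (starRingEnd ℂ) (g R) ∂haar = 0}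
      add_mem' := by
        rintro v w ⟨hv, hv0⟩ ⟨hw, hw0⟩
        refine ⟨hv.add hw, ?_⟩
        simp only [Pi.add_apply, map_add, mul_add]
        rw [integral_add (hint hv) (hint hw), hv0, hw0, add_zero]
      zero_mem' := ⟨continuous_zero, by simp⟩
      smul_mem' := by
        rintro c v ⟨hv, hv0⟩
        refine ⟨hv.const_smul c, ?_⟩
        simp only [Pi.smul_apply, smul_eq_mul, map_mul, mul_left_comm (u _)]
        rw [integral_const_mul, hv0, mul_zero] }
  exact (harmLE_le (W := W) (fun n k l hn hk hl => ⟨continuous_wignerD n k l, h n k l hn hk hl⟩)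
    hg).2

/-- A band-limited function is determined by its harmonic coefficients. -/
theorem eq_zero_of_fhat_eq_zero {N : ℕ} {g : SO3 → ℂ} (hg : g ∈ harmLE N)
    (h : ∀ (n : ℕ) (k l : ℤ), n ≤ N → |k| ≤ n → |l| ≤ n → fhat g n k l = 0) :
    g =ᵐ[haar] 0 := by
  have hc := continuous_of_mem_harmLE hg
  -- Since g lies in the span to which it is orthogonal, its own L² norm vanishes.
  have h0 := integral_mul_conj_eq_zero hc hg h
  have h1 : ∫ R, ‖g R‖ ^ 2 ∂haar = 0 := by
    simp only [Complex.mul_conj'] at h0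
    exact_mod_cast h0
  have hi : Integrable (fun R => ‖g R‖ ^ 2) haar :=
    (hc.norm.pow 2).integrable_of_hasCompactSupport (HasCompactSupport.of_compactSpace _)
  filter_upwards [(integral_eq_zero_iff_of_nonneg (fun R => by positivity) hi).1 h1] with R hR
  simpa using hR

theorem fhat_congr {f g : SO3 → ℂ} (h : f =ᵐ[haar] g) (n : ℕ) (k l : ℤ) :
    fhat f n k l = fhat g n k l :=
  integral_congr_ae (by filter_upwards [h] with R hR; rw [hR])

theorem fhat_sub {f g : SO3 → ℂ} (hf : Continuous f) (hg : Continuous g) (n : ℕ) (k l : ℤ) :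
    fhat (fun R => f R - g R) n k l = fhat f n k l - fhat g n k l := by
  have hD := Complex.continuous_conj.comp (continuous_wignerD n k l)
  simp only [fhat, sub_mul]
  exact integral_sub (integrable_of_continuous (hf.mul hD)) (integrable_of_continuous (hg.mul hD))

/-- Harmonic coefficients of `R ↦ f R⁻¹`. -/
theorem fhat_comp_inv (f : SO3 → ℂ) (n : ℕ) (k l : ℤ) :
    fhat (fun R => f R⁻¹) n k l = (-1) ^ (k + l) * fhat f n (-l) (-k) := by
  unfold fhat
  rw [← integral_inv_eq_self _ haar, ← integral_const_mul]
  refine integral_congr_ae (Filter.Eventually.of_forall fun R => ?_)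
  simp only [inv_inv, wignerD_inv, map_mul, conj_neg_one_zpow]
  ring

theorem ae_eq_comp_inv_iff {N : ℕ} {f : SO3 → ℂ} (hf : IsBandLimited N f) :
    (∀ᵐ R ∂haar, f R = f R⁻¹) ↔ ∀ (n : ℕ) (k l : ℤ), n ≤ N → |k| ≤ n → |l| ≤ n →
      fhat f n k l = (-1 : ℂ) ^ (k + l) * fhat f n (-l) (-k) := by
  constructor
  · intro h n k l _ _ _
    rw [← fhat_comp_inv]
    exact fhat_congr h n k l
  · intro h
    obtain ⟨g, hg, hfg⟩ := hf
    have hg' := comp_inv_mem_harmLE hg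
    have hz : (fun R => g R - g R⁻¹) =ᵐ[haar] 0 := by
      refine eq_zero_of_fhat_eq_zero (N := N) (Submodule.sub_mem _ hg hg') fun n k l hn hk hl => ?_
      rw [fhat_sub (continuous_of_mem_harmLE hg) (continuous_of_mem_harmLE hg'), fhat_comp_inv,
        ← fhat_congr hfg, ← fhat_congr hfg, h n k l hn hk hl, sub_self]
    -- The null set where f and g differ stays null under inversion.
    have hfg' : f ∘ Inv.inv =ᵐ[haar] g ∘ Inv.inv :=
      (Measure.measurePreserving_inv haar).quasiMeasurePreserving.ae_eq_comp hfg
    filter_upwards [hz, hfg, hfg'] with R h1 h2 h3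
    simp only [Function.comp_apply] at h3
    rw [h2, h3]
    exact sub_eq_zero.1 h1

/-! ### The Wigner transform -/

theorem wignerTransform_neg_swap (N : ℕ) (c : ℕ → ℤ → ℤ → ℂ) (k j l : ℤ) :
    wignerTransform N c (-l) (-j) (-k) =
      wignerTransform N (fun n k l => (-1) ^ (k + l) * c n (-l) (-k)) k j l := by
  unfold wignerTransform
  rw [show -l - -k = k - l by ring, Int.natAbs_neg, Int.natAbs_neg, Int.natAbs_neg,
    max_comm l.natAbs]
  congr 1
  refine Finset.sum_congr rfl fun n _ => ?_
  rw [wignerd_neg_neg, wignerd_neg_neg]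
  push_cast
  -- The signs depending on j cancel, leaving one that can be absorbed into the coefficients.
  have e : (-1 : ℂ) ^ (j + l) * (-1) ^ (j + k) = (-1) ^ (-k + -l) := by
    have hn : (-1 : ℂ) ≠ 0 := by norm_num
    rw [show -k + -l = -(k + l) by ring, zpow_neg, ← inv_zpow, inv_neg_one, zpow_add₀ hn,
      zpow_add₀ hn, zpow_add₀ hn]
    linear_combination ((-1 : ℂ) ^ k * (-1) ^ l) * neg_one_zpow_mul_self (K := ℂ) j
  simp only [neg_neg, ← e]
  ring

theorem wignerTransform_congr {N : ℕ} {c c' : ℕ → ℤ → ℤ → ℂ} {k l : ℤ}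
    (h : ∀ n : ℕ, n ≤ N → |k| ≤ n → |l| ≤ n → c n (-k) (-l) = c' n (-k) (-l)) (j : ℤ) :
    wignerTransform N c k j l = wignerTransform N c' k j l := by
  unfold wignerTransform
  congr 1
  refine Finset.sum_congr rfl fun n hn => ?_
  rw [Finset.mem_Icc] at hn
  rw [h n hn.2 (by rw [Int.abs_eq_natAbs]; omega) (by rw [Int.abs_eq_natAbs]; omega)]

/-- The Wigner transform is injective on families of harmonic coefficients. -/
theorem eq_of_wignerTransform_eq {N : ℕ} {c c' : ℕ → ℤ → ℤ → ℂ} {k l : ℤ}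
    (h : ∀ j : ℕ, j ≤ N → |k| ≤ j → |l| ≤ j →
      wignerTransform N c k j l = wignerTransform N c' k j l)
    {n : ℕ} (hn : n ≤ N) (hk : |k| ≤ n) (hl : |l| ≤ n) : c n (-k) (-l) = c' n (-k) (-l) := by
  -- Back substitution from n = N downwards: the equation with j = n involves only degrees at least
  -- n, and those above n already agree.
  induction hm : N - n using Nat.strong_induction_on generalizing n with
  | _ m ih =>
    have hj := h n hn hk hl
    unfold wignerTransform at hj
    have hmax : max (max k.natAbs l.natAbs) (n : ℤ).natAbs = n := by
      rw [Int.abs_eq_natAbs] at hk hl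
      omega
    rw [hmax, ← Finset.add_sum_Ioc_eq_sum_Icc hn, ← Finset.add_sum_Ioc_eq_sum_Icc hn] at hj
    have htail : ∀ i ∈ Finset.Ioc n N, c i (-k) (-l) = c' i (-k) (-l) := fun i hi => by
      rw [Finset.mem_Ioc] at hi
      exact ih (N - i) (by omega) hi.2 (hk.trans (by omega)) (hl.trans (by omega)) rfl
    rw [Finset.sum_congr rfl fun i hi => by rw [htail i hi]] at hj
    have hj' := add_right_cancel (mul_left_cancel₀ (zpow_ne_zero _ Complex.I_ne_zero) hj)
    refine mul_left_cancel₀ (mul_ne_zero (mul_ne_zero ?_ ?_) ?_) hj'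
    · exact Complex.ofReal_ne_zero.2 (by positivity)
    · exact Complex.ofReal_ne_zero.2 (wignerd_self_ne_zero hk)
    · exact Complex.ofReal_ne_zero.2 (wignerd_self_ne_zero hl)

/-- Both sides compare c with its reflected family, before and after the transform; injectivity uses
only the equations with j ≥ 0. -/
theorem wignerTransform_symm_iff (N : ℕ) (c : ℕ → ℤ → ℤ → ℂ) :
    (∀ (n : ℕ) (k l : ℤ), n ≤ N → |k| ≤ n → |l| ≤ n →
      c n k l = (-1 : ℂ) ^ (k + l) * c n (-l) (-k)) ↔
    ∀ k j l : ℤ, |k| ≤ N → |j| ≤ N → |l| ≤ N →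
      wignerTransform N c k j l = wignerTransform N c (-l) (-j) (-k) := by
  constructor
  · intro h k j l _ _ _
    rw [wignerTransform_neg_swap]
    exact wignerTransform_congr (fun n hn hk hl => h n (-k) (-l) hn (by rwa [abs_neg])
      (by rwa [abs_neg])) j
  · intro h n k l hn hk hl
    have key := eq_of_wignerTransform_eq (N := N) (c := c)
      (c' := fun n k l => (-1) ^ (k + l) * c n (-l) (-k)) (k := -k) (l := -l) (n := n)
      (fun j hj hkj hlj => by
        rw [← wignerTransform_neg_swap]
        have hjN : (j : ℤ) ≤ N := by exact_mod_cast hj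
        exact h _ _ _ (hkj.trans hjN) (by simpa using hjN) (hlj.trans hjN))
      hn (by rwa [abs_neg]) (by rwa [abs_neg])
    simpa only [neg_neg] using key

end SO3

theorem mainTheorem8 (N : ℕ) (f : SO3 → ℂ) (hf : SO3.IsBandLimited N f) :
    List.TFAE
      [∀ᵐ R ∂SO3.haar, f R = f R⁻¹,
        ∀ (n : ℕ) (k l : ℤ), n ≤ N → |k| ≤ n → |l| ≤ n →
          SO3.fhat f n k l = (-1 : ℂ) ^ (k + l) * SO3.fhat f n (-l) (-k),
        ∀ k j l : ℤ, |k| ≤ N → |j| ≤ N → |l| ≤ N →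
          SO3.wignerTransform N (SO3.fhat f) k j l =
            SO3.wignerTransform N (SO3.fhat f) (-l) (-j) (-k)] := by
  tfae_have 1 ↔ 2 := SO3.ae_eq_comp_inv_iff hf
  tfae_have 2 ↔ 3 := SO3.wignerTransform_symm_iff N (SO3.fhat f)
  tfae_finish
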